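/- Let $n,m,r\ge 0$ be integers, let $d_1\ge d_2\ge\dots\ge d_m\ge 0$ be integers, and let $P$ be an $r\times m$ matrix of polynomials in $\mathbb C[z_1,\dots,z_n]$ with columns $P^1,\dots,P^m$, where all entries of $P^j$ have degree at most $d_j$. Let $f$ be the $r\times m$ matrix of forms in $z=(z_0,\dots,z_n)$ whose columns are the $d_j$-homogenizations $f^j(z)=z_0^{d_j}P^j(z_1/z_0,\dots,z_n/z_0)$. Let $Z\subset\mathbb P^n$ be the set of points $[z]$ at which $f(z)\colon\mathbb C^m\to\mathbb C^r$ is not surjective, and assume that $Z$ is empty. Then there is an $m\times r$ matrix $Q$ of polynomials in $\mathbb C[z_1,\dots,z_n]$, with rows $Q_1,\dots,Q_m$, such that $$PQ=\sum_{k=1}^m P^kQ_k=I_r ,$$ and, for every $k$, all entries of the $r\times r$ matrix $P^kQ_k$ have degree at most $$\max\Big\{0,\ \sum_{j=1}^{n+r}d_j-n\Big\}$$ if $m\ge n+r$, and are constant if $m<n+r$. (If $m\ge n+r$ and all $d_j\ge 1$, then $\sum_{j=1}^{n+r}d_j-n\ge r\ge 0$, so the maximum is just $\sum_{j=1}^{n+r}d_j-n$.)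 -/

import Mathlib

open MvPolynomial

noncomputable section

/-- The `d`-homogenization `z₀ ^ d * p (z' / z₀)` of a polynomial `p` in `n` variables with
`deg p ≤ d`: every monomial `c * z' ^ s` of `p` becomes `c * z₀ ^ (d - |s|) * z' ^ s`.
The variable with index `0` is the homogenizing one. -/
def homogenizeTo {n : ℕ} (d : ℕ) (p : MvPolynomial (Fin n) ℂ) :
    MvPolynomial (Fin (n + 1)) ℂ :=
  ∑ s ∈ p.support, monomial (Finsupp.cons (d - s.degree) s) (p.coeff s)

/-- The matrix whose `j`-th column is the `d j`-homogenization of the `j`-th column of `P`. -/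
def homogenizeColumns {n m r : ℕ} (d : Fin m → ℕ)
    (P : Matrix (Fin r) (Fin m) (MvPolynomial (Fin n) ℂ)) :
    Matrix (Fin r) (Fin m) (MvPolynomial (Fin (n + 1)) ℂ) :=
  Matrix.of fun i j => homogenizeTo (d j) (P i j)

/-- The set of points `[z]` of `ℙⁿ` at which the matrix `f` of forms does not define a surjective
map `ℂᵐ → ℂʳ`. (The columns of `f` are homogeneous, so this does not depend on the choice of the
homogeneous coordinates `z` of the point.) -/
def nonSurjectiveLocus {n m r : ℕ}
    (f : Matrix (Fin r) (Fin m) (MvPolynomial (Fin (n + 1)) ℂ)) :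
    Set (Projectivization ℂ (Fin (n + 1) → ℂ)) :=
  {x | ∃ (z : Fin (n + 1) → ℂ) (hz : z ≠ 0), Projectivization.mk ℂ z hz = x ∧
    ¬ Function.Surjective (f.map (eval z)).mulVec}

end

/-!
Let `S = ℂ[z₀, …, zₙ]`, and view the homogenized matrix `f` as a graded map `F → G` of free modules
of ranks `m` and `r`. The proof shows that `z₀ ^ t` lies in the ideal of maximal minors of `f` as
soon as `t + n` is at least the sum of any `n + r` of the degrees
(`EagonNorthcott.exists_contrList_eq_X_pow`). Cramer's rule then gives a homogeneous matrix `Q` with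
`f Q = z₀ ^ t • 1` (`EagonNorthcott.exists_mul_eq_X_pow_smul`), all of whose products
`f i k * Q k l` are forms of degree `t`, and setting `z₀ = 1` finishes the proof.

Membership in the ideal of minors is controlled by the Eagon–Northcott complex
`⋯ → ⋀ ^ (r + 1) F ⊗ D₁ → ⋀ ^ r F → S`, with `D` the divided powers of the dual of `G`. Its term in
position `n + 1` is `⋀ ^ (r + n) F ⊗ Dₙ`, generated in degrees equal to sums of `n + r` of the
`d j`, and it is zero if `m < n + r`; no general position of the columns is needed. Two facts enter.

* The homology is killed by powers of every variable. By the Nullstellensatz `f` has a right inverse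
  up to a power of `z_l` (`EagonNorthcott.splitsAt_of_surjective`), and exterior multiplication by
  its columns gives contracting homotopies (`EagonNorthcott.exists_pow_smul_eq_enDiff`).
* Let `C` be such a complex over a polynomial ring in `a` variables. The homology of `C` in position
  `i` vanishes in degrees above `e - a`, with `e` the largest degree of a generator in position
  `i + a` (`EagonNorthcott.exists_enDiff_eq`, stated for the positions `i ≥ 1` of the complex at
  hand). Indeed, the exact sequence `H_{i+1}(C / z₀ C) → H_i(C)(-1) → H_i(C)` and induction on `a`
  show that `z₀` acts injectively in these degrees, while a power of `z₀` acts as zero. The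
  induction starts with no variables, where `C` itself vanishes in the degrees in question.

Thus only the homology being torsion is used, not the exactness of the complex.
-/

namespace EagonNorthcott

/-! ### Contraction and exterior multiplication on an exterior algebra -/

section Exterior

variable {R : Type*} [CommRing R] {ι : Type*} [LinearOrder ι]

/-- The sign `(-1) ^ #{j ∈ J | j < i}` of moving `e_i` into place in the basis vector `e_J` of an
exterior algebra. -/
def sgn (i : ι) (J : Finset ι) : R := (-1) ^ (J.filter (· < i)).card

theorem sgn_insert {i j : ι} {J : Finset ι} (hi : i ∉ J) :
    (sgn j (insert i J) : R) = (if i < j then -1 else 1) * sgn j J := by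
  unfold sgn
  rw [Finset.filter_insert]
  split_ifs with h
  · rw [Finset.card_insert_of_notMem (by simp [hi]), pow_succ]; ring
  · rw [one_mul]

theorem sgn_erase {i j : ι} {J : Finset ι} (hi : i ∈ J) :
    (sgn j J : R) = (if i < j then -1 else 1) * sgn j (J.erase i) := by
  rw [← sgn_insert (Finset.notMem_erase i J), Finset.insert_erase hi]

theorem sgn_mul_self (i : ι) (J : Finset ι) : (sgn i J : R) * sgn i J = 1 := by
  rw [sgn, ← mul_pow]; simp

/-- Contraction by the `i`-th coordinate form on the exterior algebra of `R ^ ι`. An element of the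
exterior algebra is encoded by its coordinates `Finset ι → R` with respect to the basis `e_J`. -/
def ann (i : ι) : Module.End R (Finset ι → R) where
  toFun x J := if i ∈ J then 0 else sgn i J * x (insert i J)
  map_add' x y := by ext J; simp only [Pi.add_apply]; split_ifs <;> ring
  map_smul' a x := by
    ext J; simp only [Pi.smul_apply, smul_eq_mul, RingHom.id_apply]; split_ifs <;> ring

/-- Left multiplication by the basis vector `e_i` on the exterior algebra `Finset ι → R`. -/
def cre (i : ι) : Module.End R (Finset ι → R) where
  toFun x J := if i ∈ J then sgn i J * x (J.erase i) else 0
  map_add' x y := by ext J; simp only [Pi.add_apply]; split_ifs <;> ring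
  map_smul' a x := by
    ext J; simp only [Pi.smul_apply, smul_eq_mul, RingHom.id_apply]; split_ifs <;> ring

theorem ann_apply (i : ι) (x : Finset ι → R) (J : Finset ι) :
    ann i x J = if i ∈ J then 0 else sgn i J * x (insert i J) := rfl

theorem cre_apply (i : ι) (x : Finset ι → R) (J : Finset ι) :
    cre i x J = if i ∈ J then sgn i J * x (J.erase i) else 0 := rfl

theorem ann_mul_self (i : ι) : (ann i : Module.End R (Finset ι → R)) * ann i = 0 := by
  refine LinearMap.ext fun x => funext fun J => ?_
  simp [ann_apply]

theorem ann_mul_ann (i j : ι) :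
    (ann i : Module.End R (Finset ι → R)) * ann j = -(ann j * ann i) := by
  rcases eq_or_ne i j with rfl | hij
  · simp [ann_mul_self]
  refine LinearMap.ext fun x => funext fun J => ?_
  simp only [Module.End.mul_apply, LinearMap.neg_apply, Pi.neg_apply, ann_apply,
    Finset.mem_insert, hij, hij.symm, false_or]
  by_cases hi : i ∈ J <;> by_cases hj : j ∈ J <;>
    simp only [hi, hj, if_true, if_false, mul_zero, neg_zero]
  rw [sgn_insert hi, sgn_insert hj, Finset.insert_comm]
  rcases lt_or_gt_of_ne hij with h | h
  · rw [if_pos h, if_neg h.not_gt]; ring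
  · rw [if_neg h.not_gt, if_pos h]; ring

/-- Together with `ann_mul_ann`, the canonical anticommutation relations. -/
theorem ann_mul_cre (i j : ι) :
    (ann i : Module.End R (Finset ι → R)) * cre j + cre j * ann i = if i = j then 1 else 0 := by
  refine LinearMap.ext fun x => funext fun J => ?_
  rcases eq_or_ne i j with rfl | hij
  · simp only [LinearMap.add_apply, Module.End.mul_apply, Pi.add_apply, ann_apply, cre_apply,
      Finset.mem_insert_self, Finset.notMem_erase, if_true, if_false, Module.End.one_apply]
    by_cases hi : i ∈ J
    · rw [if_pos hi, if_pos hi, Finset.insert_erase hi, sgn_erase hi, if_neg (lt_irrefl i),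
        one_mul, zero_add, ← mul_assoc, sgn_mul_self, one_mul]
    · rw [if_neg hi, if_neg hi, Finset.erase_insert hi, sgn_insert hi, if_neg (lt_irrefl i),
        one_mul, add_zero, ← mul_assoc, sgn_mul_self, one_mul]
  · simp only [LinearMap.add_apply, Module.End.mul_apply, Pi.add_apply, ann_apply, cre_apply,
      Finset.mem_insert, Finset.mem_erase, hij, hij.symm, if_false, false_or, ne_eq,
      not_false_eq_true, true_and, LinearMap.zero_apply, Pi.zero_apply]
    by_cases hi : i ∈ J <;> by_cases hj : j ∈ J <;>
      simp only [hi, hj, if_true, if_false, mul_zero, add_zero]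
    rw [sgn_insert hi, sgn_erase (i := j) (j := i) hj, Finset.erase_insert_of_ne hij]
    rcases lt_or_gt_of_ne hij with h | h
    · rw [if_pos h, if_neg h.not_gt]; ring
    · rw [if_neg h.not_gt, if_pos h]; ring

variable [Fintype ι]

/-- Contraction by the linear form with coefficients `φ` on the exterior algebra `Finset ι → R`. -/
def contr (φ : ι → R) : Module.End R (Finset ι → R) := ∑ i, φ i • ann i

/-- Left multiplication by the vector `v` on the exterior algebra `Finset ι → R`. -/
def wedge (v : ι → R) : Module.End R (Finset ι → R) := ∑ i, v i • cre i

theorem contr_apply (φ : ι → R) (x : Finset ι → R) (J : Finset ι) :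
    contr φ x J = ∑ i, φ i * (if i ∈ J then 0 else sgn i J * x (insert i J)) := by
  simp [contr, LinearMap.sum_apply, Finset.sum_apply, ann_apply]

theorem wedge_apply (v : ι → R) (x : Finset ι → R) (J : Finset ι) :
    wedge v x J = ∑ i, v i * (if i ∈ J then sgn i J * x (J.erase i) else 0) := by
  simp [wedge, LinearMap.sum_apply, Finset.sum_apply, cre_apply]

theorem contr_contr_comm (φ ψ : ι → R) (x : Finset ι → R) :
    contr φ (contr ψ x) = -contr ψ (contr φ x) := by
  rw [← Module.End.mul_apply, ← Module.End.mul_apply, ← LinearMap.neg_apply]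
  congr 1
  rw [contr, contr, Finset.sum_mul_sum, Finset.sum_mul_sum, Finset.sum_comm,
    ← Finset.sum_neg_distrib]
  refine Finset.sum_congr rfl fun i _ => ?_
  rw [← Finset.sum_neg_distrib]
  refine Finset.sum_congr rfl fun j _ => ?_
  rw [smul_mul_smul_comm, smul_mul_smul_comm, ann_mul_ann j i, smul_neg, mul_comm]

theorem contr_contr_self (φ : ι → R) (x : Finset ι → R) : contr φ (contr φ x) = 0 := by
  suffices h : contr φ * contr φ = 0 by rw [← Module.End.mul_apply, h, LinearMap.zero_apply]
  rw [contr, Finset.sum_mul_sum, ← Finset.sum_product']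
  refine Finset.sum_involution (fun p _ => (p.2, p.1)) ?_ ?_ ?_ ?_
  · rintro ⟨i, j⟩ -
    simp only
    rw [smul_mul_smul_comm, smul_mul_smul_comm, ann_mul_ann j i, smul_neg, mul_comm (φ j),
      add_neg_cancel]
  · rintro ⟨i, j⟩ - h h'
    obtain rfl : j = i := congrArg Prod.fst h'
    exact h (by simp only [smul_mul_smul_comm, ann_mul_self, smul_zero])
  · simp
  · simp

theorem contr_wedge (φ v : ι → R) (x : Finset ι → R) :
    contr φ (wedge v x) + wedge v (contr φ x) = (φ ⬝ᵥ v) • x := by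
  suffices h : contr φ * wedge v + wedge v * contr φ = (φ ⬝ᵥ v) • 1 by
    simpa using LinearMap.congr_fun h x
  rw [contr, wedge, Finset.sum_mul_sum, Finset.sum_mul_sum,
    Finset.sum_comm (γ := ι) (f := fun i j => (v i • cre i) * (φ j • ann j)),
    ← Finset.sum_add_distrib, dotProduct, Finset.sum_smul]
  refine Finset.sum_congr rfl fun i _ => ?_
  rw [← Finset.sum_add_distrib]
  have : ∀ j, (φ i • ann i * v j • cre j + v j • cre j * φ i • ann i :
      Module.End R (Finset ι → R)) = if i = j then (φ i * v j) • 1 else 0 := by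
    intro j
    rw [smul_mul_smul_comm, smul_mul_smul_comm, mul_comm (v j), ← smul_add, ann_mul_cre]
    split_ifs <;> simp
  rw [Finset.sum_congr rfl fun j _ => this j]
  simp

end Exterior

/-! ### Iterated contractions and the Eagon–Northcott differential -/

section Exterior
variable {R : Type*} [CommRing R] {ι : Type*} [LinearOrder ι] [Fintype ι]

theorem map_contr {R' : Type*} [CommRing R'] (g : R →+* R') (φ : ι → R) (x : Finset ι → R) :
    g ∘ contr φ x = contr (g ∘ φ) (g ∘ x) := by
  funext J
  simp only [Function.comp_apply, contr_apply, map_sum, map_mul]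
  refine Finset.sum_congr rfl fun i _ => ?_
  split_ifs <;> simp [sgn]

/-- Successive contraction by the rows `f k`, for `k` in the list `l` (the last entry acts first).
For `l = List.finRange r` and `x` in the `r`-th exterior power, this is (up to sign) the pairing of
`x` with the maximal minors of `f`. -/
def contrList {r : ℕ} (f : Fin r → ι → R) (l : List (Fin r)) (x : Finset ι → R) : Finset ι → R :=
  l.foldr (fun k => contr (f k)) x

variable {r : ℕ} (f : Fin r → ι → R)

theorem contrList_cons (k : Fin r) (l : List (Fin r)) (x : Finset ι → R) :
    contrList f (k :: l) x = contr (f k) (contrList f l x) := rfl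

theorem map_contrList {R' : Type*} [CommRing R'] (g : R →+* R') (l : List (Fin r))
    (x : Finset ι → R) :
    g ∘ contrList f l x = contrList (fun k => g ∘ f k) l (g ∘ x) := by
  induction l with
  | nil => rfl
  | cons k l ih => rw [contrList_cons, contrList_cons, map_contr, ih]

theorem contrList_smul (l : List (Fin r)) (a : R) (x : Finset ι → R) :
    contrList f l (a • x) = a • contrList f l x := by
  induction l with
  | nil => rfl
  | cons k l ih => rw [contrList_cons, contrList_cons, ih, map_smul]

theorem contrList_sub (l : List (Fin r)) (x y : Finset ι → R) :
    contrList f l (x - y) = contrList f l x - contrList f l y := by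
  induction l with
  | nil => rfl
  | cons k l ih => rw [contrList_cons, contrList_cons, contrList_cons, ih, map_sub]

theorem contrList_sum {α : Type*} (s : Finset α) (l : List (Fin r)) (x : α → Finset ι → R) :
    contrList f l (∑ a ∈ s, x a) = ∑ a ∈ s, contrList f l (x a) := by
  induction l with
  | nil => rfl
  | cons k l ih => simp only [contrList_cons, ih, map_sum]

theorem contrList_contr (l : List (Fin r)) (φ : ι → R) (x : Finset ι → R) :
    contrList f l (contr φ x) = (-1 : R) ^ l.length • contr φ (contrList f l x) := by
  induction l with
  | nil => simp [contrList]
  | cons k l ih =>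
    rw [contrList_cons, contrList_cons, ih, map_smul, contr_contr_comm, List.length_cons, pow_succ,
      mul_neg_one, neg_smul, smul_neg]

theorem contr_contrList_of_mem {k : Fin r} {l : List (Fin r)} (hk : k ∈ l) (x : Finset ι → R) :
    contr (f k) (contrList f l x) = 0 := by
  induction l with
  | nil => simp at hk
  | cons j l ih =>
    rw [contrList_cons]
    rcases List.mem_cons.1 hk with rfl | hk
    · exact contr_contr_self _ _
    · rw [contr_contr_comm, ih hk, map_zero, neg_zero]

theorem contrList_contr_of_mem {k : Fin r} {l : List (Fin r)} (hk : k ∈ l) (x : Finset ι → R) :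
    contrList f l (contr (f k) x) = 0 := by
  rw [contrList_contr, contr_contrList_of_mem f hk, smul_zero]

/-- The differential of the Eagon–Northcott complex of the matrix with rows `f k`, in its part
`⋀ F ⊗ D`. Here `D` is the divided power module with basis the inverse monomials `w ^ (-β)`, so that
a chain is a function `x` of `β`, and multiplication by `w_k` is `x ↦ (β ↦ x (β + e_k))`; the
differential is `∑ k, contr (f k) ⊗ w_k`. -/
def enDiff : Module.End R ((Fin r → ℕ) → Finset ι → R) where
  toFun x β := ∑ k, contr (f k) (x (β + Pi.single k 1))
  map_add' x y := by funext β; simp [Finset.sum_add_distrib]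
  map_smul' a x := by funext β; simp [Finset.smul_sum]

theorem enDiff_apply (x : (Fin r → ℕ) → Finset ι → R) (β : Fin r → ℕ) :
    enDiff f x β = ∑ k, contr (f k) (x (β + Pi.single k 1)) := rfl

theorem enDiff_enDiff (x : (Fin r → ℕ) → Finset ι → R) : enDiff f (enDiff f x) = 0 := by
  funext β
  simp only [enDiff_apply, map_sum, Pi.zero_apply]
  rw [← Finset.sum_product']
  refine Finset.sum_involution (fun p _ => (p.2, p.1)) ?_ ?_ ?_ ?_
  · rintro ⟨i, j⟩ -
    simp only
    rw [contr_contr_comm, add_right_comm β, neg_add_cancel]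
  · rintro ⟨i, j⟩ - h h'
    obtain rfl : j = i := congrArg Prod.fst h'
    exact h (contr_contr_self _ _)
  · simp
  · simp

theorem contrList_enDiff (x : (Fin r → ℕ) → Finset ι → R) (β : Fin r → ℕ) :
    contrList f (List.finRange r) (enDiff f x β) = 0 := by
  rw [enDiff_apply, contrList_sum]
  exact Finset.sum_eq_zero fun k _ => contrList_contr_of_mem f (List.mem_finRange k) _

theorem map_enDiff {R' : Type*} [CommRing R'] (g : R →+* R') (x : (Fin r → ℕ) → Finset ι → R)
    (β : Fin r → ℕ) :
    g ∘ enDiff f x β = enDiff (fun k => g ∘ f k) (fun β => g ∘ x β) β := by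
  rw [enDiff_apply, enDiff_apply]
  simp only [← map_contr]
  funext J
  simp [Finset.sum_apply]

/-- Contracting by all rows in `l` can be done by contracting with the `k`-th row last; the
intermediate result is killed by the other rows. The predicate `P` records the grading. -/
theorem exists_contrList_eq {k : Fin r} {l : List (Fin r)} (hl : l.Nodup) (hk : k ∈ l)
    (P : ℕ → (Finset ι → R) → Prop) (hneg : ∀ p x, P p x → P p (-x))
    (hP : ∀ p x i, P (p + 1) x → P p (contr (f i) x)) {p : ℕ} {x : Finset ι → R}
    (hx : P (p + l.length) x) :
    ∃ y, P (p + 1) y ∧ contrList f l x = contr (f k) y ∧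
      ∀ j ∈ l, j ≠ k → contr (f j) y = 0 := by
  have aux : ∀ (l : List (Fin r)) (p : ℕ), P (p + l.length) x → P p (contrList f l x) := by
    intro l
    induction l with
    | nil => exact fun p h => h
    | cons i l ih =>
      intro p h
      refine hP _ _ _ (ih _ ?_)
      rwa [List.length_cons, ← add_assoc, add_right_comm] at h
  induction l generalizing p with
  | nil => simp at hk
  | cons i l ih =>
    have hx' : P (p + 1 + l.length) x := by
      rwa [List.length_cons, ← add_assoc, add_right_comm] at hx
    rw [List.nodup_cons] at hl
    by_cases hki : k = i
    · subst hki
      refine ⟨contrList f l x, aux l _ hx', rfl, fun j hj hjk => ?_⟩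
      exact contr_contrList_of_mem f ((List.mem_cons.1 hj).resolve_left hjk) x
    · obtain ⟨y, hy, hxy, hjy⟩ := ih hl.2 ((List.mem_cons.1 hk).resolve_left hki) hx'
      refine ⟨-contr (f i) y, hneg _ _ (hP _ _ _ hy), ?_, fun j hj hjk => ?_⟩
      · rw [contrList_cons, hxy, contr_contr_comm, map_neg]
      · rw [map_neg, neg_eq_zero]
        rcases List.mem_cons.1 hj with rfl | hj
        · exact contr_contr_self _ _
        · rw [contr_contr_comm, hjy j hj hjk, map_zero, neg_zero]

end Exterior

/-! ### Grading of the complex -/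

section Graded

variable {K : Type*} [CommRing K] {σ ι : Type*}

/-- Elements of the `p`-th exterior power of internal degree `t`, where `e_J` has internal degree
`∑ j ∈ J, d j`. The condition is on each coefficient, so `0` is in every `formPart`. -/
def formPart (d : ι → ℕ) (p t : ℕ) : Submodule K (Finset ι → MvPolynomial σ K) where
  carrier := {x | ∀ J s, coeff s (x J) ≠ 0 → J.card = p ∧ s.degree + ∑ j ∈ J, d j = t}
  zero_mem' J s h := by simp at h
  add_mem' {x y} hx hy J s h := by
    rw [Pi.add_apply, coeff_add] at h
    by_cases h' : coeff s (x J) = 0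
    · exact hy J s (by simpa [h'] using h)
    · exact hx J s h'
  smul_mem' a x hx J s h := hx J s fun h' => h (by simp [h'])

theorem exists_coeff_ne_zero_of_coeff_mul {p q : MvPolynomial σ K} {s : σ →₀ ℕ}
    (h : coeff s (p * q) ≠ 0) : ∃ u v, u + v = s ∧ coeff u p ≠ 0 ∧ coeff v q ≠ 0 := by
  classical
  rw [coeff_mul] at h
  obtain ⟨⟨u, v⟩, huv, h⟩ := Finset.exists_ne_zero_of_sum_ne_zero h
  exact ⟨u, v, Finset.HasAntidiagonal.mem_antidiagonal.1 huv,
    left_ne_zero_of_mul h, right_ne_zero_of_mul h⟩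

theorem smul_mem_formPart {d : ι → ℕ} {Z : MvPolynomial σ K} {N : ℕ}
    (hZ : ∀ s, coeff s Z ≠ 0 → s.degree = N) {p t : ℕ}
    {x : Finset ι → MvPolynomial σ K} (hx : x ∈ formPart d p t) :
    Z • x ∈ formPart d p (t + N) := by
  intro J s h
  obtain ⟨u, v, rfl, hu, hv⟩ := exists_coeff_ne_zero_of_coeff_mul h
  obtain ⟨h1, h2⟩ := hx _ _ hv
  have := hZ u hu
  rw [map_add]
  omega

theorem pow_degree {Z : MvPolynomial σ K} {N : ℕ} (hZ : ∀ s, coeff s Z ≠ 0 → s.degree = N)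
    (k : ℕ) (s : σ →₀ ℕ) (h : coeff s (Z ^ k) ≠ 0) : s.degree = k * N := by
  induction k generalizing s with
  | zero =>
    classical
    rw [pow_zero, coeff_one] at h
    have : 0 = s := by by_contra h'; simp [h'] at h
    simp [← this]
  | succ k ih =>
    rw [pow_succ] at h
    obtain ⟨u, v, rfl, hu, hv⟩ := exists_coeff_ne_zero_of_coeff_mul h
    rw [map_add, ih u hu, hZ v hv]; ring

variable {r : ℕ}

/-- Chains in `⋀ ^ (r + q) F ⊗ D_q` of internal degree `t`. -/
def chains (r : ℕ) (d : ι → ℕ) (q t : ℕ) :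
    Submodule K ((Fin r → ℕ) → Finset ι → MvPolynomial σ K) where
  carrier := {x | ∀ β, x β ∈ formPart d (r + q) t ∧ (∑ k, β k ≠ q → x β = 0)}
  zero_mem' β := ⟨zero_mem _, fun _ => rfl⟩
  add_mem' {x y} hx hy β := ⟨add_mem (hx β).1 (hy β).1, fun h => by
    rw [Pi.add_apply, (hx β).2 h, (hy β).2 h, add_zero]⟩
  smul_mem' a x hx β := ⟨Submodule.smul_mem _ a (hx β).1, fun h => by
    rw [Pi.smul_apply, (hx β).2 h, smul_zero]⟩

theorem sum_add_single (β : Fin r → ℕ) (k : Fin r) :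
    ∑ j, (β + Pi.single k 1 : Fin r → ℕ) j = ∑ j, β j + 1 := by
  simp [Finset.sum_add_distrib]

theorem smul_mem_chains {d : ι → ℕ} {Z : MvPolynomial σ K} {N : ℕ}
    (hZ : ∀ s, coeff s Z ≠ 0 → s.degree = N) {q t : ℕ}
    {x : (Fin r → ℕ) → Finset ι → MvPolynomial σ K} (hx : x ∈ chains r d q t) :
    Z • x ∈ chains r d q (t + N) := fun β =>
  ⟨smul_mem_formPart hZ (hx β).1, fun h => by rw [Pi.smul_apply, (hx β).2 h, smul_zero]⟩

variable [LinearOrder ι]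

theorem coeff_sgn_mul {i : ι} {J : Finset ι} {p : MvPolynomial σ K} {s : σ →₀ ℕ}
    (h : coeff s (sgn i J * p) ≠ 0) : coeff s p ≠ 0 := by
  rcases neg_one_pow_eq_or (MvPolynomial σ K) (J.filter (· < i)).card with h' | h' <;>
    rw [sgn, h'] at h <;> simpa using h

variable [Fintype ι]

theorem contr_mem {d : ι → ℕ} {φ : ι → MvPolynomial σ K}
    (hφ : ∀ j s, coeff s (φ j) ≠ 0 → s.degree = d j) {p t : ℕ}
    {x : Finset ι → MvPolynomial σ K} (hx : x ∈ formPart d (p + 1) t) :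
    contr φ x ∈ formPart d p t := by
  intro J s h
  rw [contr_apply, coeff_sum] at h
  obtain ⟨i, -, h⟩ := Finset.exists_ne_zero_of_sum_ne_zero h
  obtain ⟨u, v, rfl, hu, hv⟩ := exists_coeff_ne_zero_of_coeff_mul h
  split_ifs at hv with hi
  · simp at hv
  obtain ⟨h1, h2⟩ := hx _ _ (coeff_sgn_mul hv)
  rw [Finset.card_insert_of_notMem hi] at h1
  rw [Finset.sum_insert hi] at h2
  have := hφ i u hu
  rw [map_add]
  omega

theorem wedge_mem {d : ι → ℕ} {a : ι → MvPolynomial σ K} {N : ℕ}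
    (ha : ∀ j s, coeff s (a j) ≠ 0 → s.degree + d j = N) {p t : ℕ}
    {x : Finset ι → MvPolynomial σ K} (hx : x ∈ formPart d p t) :
    wedge a x ∈ formPart d (p + 1) (t + N) := by
  intro J s h
  rw [wedge_apply, coeff_sum] at h
  obtain ⟨i, -, h⟩ := Finset.exists_ne_zero_of_sum_ne_zero h
  obtain ⟨u, v, rfl, hu, hv⟩ := exists_coeff_ne_zero_of_coeff_mul h
  split_ifs at hv with hi
  swap
  · simp at hv
  obtain ⟨h1, h2⟩ := hx _ _ (coeff_sgn_mul hv)
  have h3 := Finset.card_erase_add_one hi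
  have h4 := Finset.sum_erase_add J d hi
  have := ha i u hu
  rw [map_add]
  omega

theorem enDiff_mem {d : ι → ℕ} {f : Fin r → ι → MvPolynomial σ K}
    (hf : ∀ k j s, coeff s (f k j) ≠ 0 → s.degree = d j) {q t : ℕ}
    {x : (Fin r → ℕ) → Finset ι → MvPolynomial σ K} (hx : x ∈ chains r d (q + 1) t) :
    enDiff f x ∈ chains r d q t := by
  intro β
  rw [enDiff_apply]
  refine ⟨Submodule.sum_mem _ fun k _ => contr_mem (hf k) (hx _).1, fun h => ?_⟩
  refine Finset.sum_eq_zero fun k _ => ?_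
  rw [(hx _).2 (by rw [sum_add_single]; omega), map_zero]

end Graded

/-! ### Homotopies: the homology is torsion -/

section Torsion

variable {K : Type*} [CommRing K] {σ ι : Type*} [LinearOrder ι] [Fintype ι] {r : ℕ}
  {d : ι → ℕ} {f A : Fin r → ι → MvPolynomial σ K} {Z : MvPolynomial σ K} {N : ℕ}

/-- Torsion of the homology at `⋀ ^ r F`: an element on which all maximal minors vanish becomes,
after multiplication by a power of `Z`, a sum of contractions by the rows of `f`. -/
theorem exists_smul_eq_sum_contr
    (hf : ∀ k j s, coeff s (f k j) ≠ 0 → s.degree = d j)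
    (hA : ∀ k j s, coeff s (A k j) ≠ 0 → s.degree + d j = N)
    (hZ : ∀ s, coeff s Z ≠ 0 → s.degree = N)
    (hfA : ∀ k k', f k ⬝ᵥ A k' = if k = k' then Z else 0)
    {l : List (Fin r)} (hl : l.Nodup) {p t : ℕ} {x : Finset ι → MvPolynomial σ K}
    (hx : x ∈ formPart d (p + l.length) t) (h0 : contrList f l x = 0) :
    ∃ y : Fin r → Finset ι → MvPolynomial σ K,
      (∀ k, y k ∈ formPart d (p + l.length + 1) (t + l.length * N)) ∧ (∀ k ∉ l, y k = 0) ∧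
      Z ^ l.length • x = ∑ k, contr (f k) (y k) := by
  induction l generalizing x with
  | nil => exact ⟨0, fun k => zero_mem _, fun _ _ => rfl, by simpa [contrList] using h0⟩
  | cons i l ih =>
    rw [List.nodup_cons] at hl
    have hx' : contr (f i) x ∈ formPart d (p + l.length) t := contr_mem (hf i) hx
    obtain ⟨y, hy, hyl, hxy⟩ := ih hl.2 hx' (by
      rw [contrList_contr, ← contrList_cons, h0, smul_zero])
    have hyi : y i = 0 := hyl i hl.1
    have hN : t + (i :: l).length * N = t + l.length * N + N := by
      rw [List.length_cons]; ring
    refine ⟨Function.update (fun k => -wedge (A i) (y k)) i (Z ^ l.length • wedge (A i) x),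
      fun k => ?_, fun k hk => ?_, ?_⟩
    · rcases eq_or_ne k i with rfl | hk
      · rw [Function.update_self, hN, add_right_comm (t : ℕ)]
        exact smul_mem_formPart (pow_degree hZ _) (wedge_mem (hA k) hx)
      · rw [Function.update_of_ne hk, hN]
        exact neg_mem (wedge_mem (hA i) (hy k))
    · rw [List.mem_cons, not_or] at hk
      rw [Function.update_of_ne hk.1, hyl k hk.2, map_zero, neg_zero]
    · have h1 : ∀ k, contr (f k) (Function.update (fun k => -wedge (A i) (y k)) i
          (Z ^ l.length • wedge (A i) x) k) =
          wedge (A i) (contr (f k) (y k)) +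
            if k = i then Z ^ l.length • contr (f i) (wedge (A i) x) else 0 := by
        intro k
        rcases eq_or_ne k i with rfl | hk
        · rw [Function.update_self, if_pos rfl, hyi, map_zero, map_zero, zero_add, map_smul]
        · rw [Function.update_of_ne hk, if_neg hk, add_zero, map_neg]
          have := contr_wedge (f k) (A i) (y k)
          rw [hfA, if_neg hk, zero_smul] at this
          exact (eq_neg_of_add_eq_zero_right this).symm
      rw [Finset.sum_congr rfl fun k _ => h1 k, Finset.sum_add_distrib, ← map_sum, ← hxy,
        Finset.sum_ite_eq' Finset.univ i, if_pos (Finset.mem_univ i), map_smul, ← smul_add,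
        add_comm, contr_wedge, hfA, if_pos rfl, smul_smul, List.length_cons, pow_succ]

/-- Torsion of the cokernel of the minors: `contr (f k) x = 0` for all `k` makes a power of `Z`
times `x` an iterated contraction. -/
theorem exists_contrList_eq_pow_smul
    (hA : ∀ k j s, coeff s (A k j) ≠ 0 → s.degree + d j = N)
    (hfA : ∀ k k', f k ⬝ᵥ A k' = if k = k' then Z else 0)
    {l : List (Fin r)} (hl : l.Nodup) {p t : ℕ} {x : Finset ι → MvPolynomial σ K}
    (hx : x ∈ formPart d p t) (h0 : ∀ k ∈ l, contr (f k) x = 0) :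
    ∃ y ∈ formPart d (p + l.length) (t + l.length * N), contrList f l y = Z ^ l.length • x := by
  induction l generalizing p t x with
  | nil => exact ⟨x, by simpa using hx, by simp [contrList]⟩
  | cons i l ih =>
    rw [List.nodup_cons] at hl
    obtain ⟨y, hy, hyx⟩ := ih hl.2 (wedge_mem (hA i) hx) (fun k hk => by
      have hki : k ≠ i := fun h => hl.1 (h ▸ hk)
      have := contr_wedge (f k) (A i) x
      rwa [h0 k (List.mem_cons_of_mem _ hk), map_zero, add_zero, hfA, if_neg hki,
        zero_smul] at this)
    refine ⟨y, ?_, ?_⟩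
    · convert hy using 1
      rw [List.length_cons]
      congr 1 <;> ring
    · have := contr_wedge (f i) (A i) x
      rw [h0 i List.mem_cons_self, map_zero, add_zero, hfA, if_pos rfl] at this
      rw [contrList_cons, hyx, map_smul, this, smul_smul, List.length_cons, pow_succ]

/-- The operator `h = wedge (A i) ⊗ w_i⁻¹` is a homotopy between `Z` and the projection
`wedge (A i) ∘ contr (f i)` on the part `β i = 0`, evaluated here on cycles. -/
theorem exists_smul_eq_enDiff_add
    (hA : ∀ k j s, coeff s (A k j) ≠ 0 → s.degree + d j = N)
    (hfA : ∀ k k', f k ⬝ᵥ A k' = if k = k' then Z else 0)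
    (i : Fin r) {q t : ℕ} {x : (Fin r → ℕ) → Finset ι → MvPolynomial σ K}
    (hx : x ∈ chains r d q t) (h0 : enDiff f x = 0) :
    ∃ y ∈ chains r d (q + 1) (t + N), ∀ β,
      Z • x β = enDiff f y β + if β i = 0 then wedge (A i) (contr (f i) (x β)) else 0 := by
  -- the subtraction in `β - Pi.single i 1` is truncated, hence the case distinction
  refine ⟨fun β => if β i = 0 then 0 else wedge (A i) (x (β - Pi.single i 1)), fun β => ?_,
    fun β => ?_⟩
  · dsimp only
    split_ifs with hi
    · exact ⟨zero_mem _, fun _ => rfl⟩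
    · refine ⟨wedge_mem (hA i) (hx _).1, fun h => ?_⟩
      rw [(hx _).2, map_zero]
      intro h'
      apply h
      rw [← h', ← sum_add_single _ i]
      refine Finset.sum_congr rfl fun k _ => ?_
      rcases eq_or_ne k i with rfl | hk
      · simp only [Pi.add_apply, Pi.sub_apply, Pi.single_eq_same]; omega
      · simp [hk]
  · rw [enDiff_apply]
    by_cases hi : β i = 0
    · rw [if_pos hi, Finset.sum_eq_single i]
      · rw [if_neg (by simp), add_tsub_cancel_right, contr_wedge, hfA, if_pos rfl]
      · intro k _ hk
        rw [if_pos (by simp [hi, hk.symm]), map_zero]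
      · simp
    · -- `β - Pi.single i 1 + Pi.single i 1 = β` as `β i ≠ 0`
      have hβ : β - Pi.single i 1 + Pi.single i 1 = β := by
        funext k
        rcases eq_or_ne k i with rfl | hk
        · simp only [Pi.add_apply, Pi.sub_apply, Pi.single_eq_same]; omega
        · simp [hk]
      have hk : ∀ k, contr (f k) (if (β + Pi.single k 1 : Fin r → ℕ) i = 0 then 0
          else wedge (A i) (x (β + Pi.single k 1 - Pi.single i 1))) =
          (if k = i then Z • x β else 0) -
            wedge (A i) (contr (f k) (x (β - Pi.single i 1 + Pi.single k 1))) := by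
        intro k
        have hc : β + Pi.single k 1 - Pi.single i 1 = β - Pi.single i 1 + Pi.single k 1 := by
          conv_lhs => rw [← hβ, add_right_comm, add_tsub_cancel_right]
        have hw := contr_wedge (f k) (A i) (x (β - Pi.single i 1 + Pi.single k 1))
        rw [hfA] at hw
        rw [if_neg (by simp [hi]), hc, eq_sub_of_add_eq hw]
        congr 1
        split_ifs with h
        · rw [h, hβ]
        · rw [zero_smul]
      have h0' := congrFun h0 (β - Pi.single i 1)
      rw [enDiff_apply, Pi.zero_apply] at h0'
      rw [if_neg hi, add_zero, Finset.sum_congr rfl fun k _ => hk k, Finset.sum_sub_distrib,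
        ← map_sum, h0', map_zero, sub_zero, Finset.sum_ite_eq' Finset.univ i,
        if_pos (Finset.mem_univ i)]

/-- Iterating `exists_smul_eq_enDiff_add` over the rows in `l` moves a cycle, up to a power of `Z`,
to the part where `β k = 0` for all `k ∈ l`. -/
theorem exists_pow_smul_eq_enDiff_add
    (hf : ∀ k j s, coeff s (f k j) ≠ 0 → s.degree = d j)
    (hA : ∀ k j s, coeff s (A k j) ≠ 0 → s.degree + d j = N)
    (hZ : ∀ s, coeff s Z ≠ 0 → s.degree = N)
    (hfA : ∀ k k', f k ⬝ᵥ A k' = if k = k' then Z else 0)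
    (l : List (Fin r)) {q t : ℕ} {x : (Fin r → ℕ) → Finset ι → MvPolynomial σ K}
    (hx : x ∈ chains r d q t) (h0 : enDiff f x = 0) :
    ∃ y ∈ chains r d (q + 1) (t + l.length * N), ∃ x' ∈ chains r d q (t + l.length * N),
      enDiff f x' = 0 ∧ Z ^ l.length • x = enDiff f y + x' ∧
      ∀ β, (∃ k ∈ l, β k ≠ 0) → x' β = 0 := by
  induction l with
  | nil => exact ⟨0, zero_mem _, x, by simpa using hx, h0, by simp, by simp⟩
  | cons i l ih =>
    obtain ⟨y, hy, x', hx', h0', hxy, hx0⟩ := ih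
    obtain ⟨y', hy', hxy'⟩ := exists_smul_eq_enDiff_add hA hfA i hx' h0'
    have hN : t + (i :: l).length * N = t + l.length * N + N := by
      rw [List.length_cons]; ring
    have hy2 : Z • x' - enDiff f y' ∈ chains r d q (t + l.length * N + N) :=
      sub_mem (smul_mem_chains hZ hx') (enDiff_mem hf hy')
    rw [hN]
    refine ⟨Z • y + y', add_mem (smul_mem_chains hZ hy) hy', Z • x' - enDiff f y', hy2,
      ?_, ?_, fun β hβ => ?_⟩
    · rw [map_sub, map_smul, h0', smul_zero, enDiff_enDiff, sub_zero]
    · rw [List.length_cons, pow_succ', mul_smul, hxy, map_add, map_smul, smul_add]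
      abel
    · have hsub : (Z • x' - enDiff f y') β =
          if β i = 0 then wedge (A i) (contr (f i) (x' β)) else 0 := by
        rw [Pi.sub_apply, Pi.smul_apply, hxy' β, add_sub_cancel_left]
      rw [hsub]
      obtain ⟨k, hk, hβ⟩ := hβ
      split_ifs with hi
      · rcases List.mem_cons.1 hk with rfl | hk
        · exact absurd hi hβ
        · rw [hx0 β ⟨k, hk, hβ⟩, map_zero, map_zero]
      · rfl

/-- If `f` has the right inverse `A` up to the factor `Z`, then `Z ^ r` kills the homology. The
condition on `x 0` says that `x` is a cycle at the splice `⋀ ^ r F → S`; it is void for `q ≠ 0`. -/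
theorem exists_pow_smul_eq_enDiff
    (hf : ∀ k j s, coeff s (f k j) ≠ 0 → s.degree = d j)
    (hA : ∀ k j s, coeff s (A k j) ≠ 0 → s.degree + d j = N)
    (hZ : ∀ s, coeff s Z ≠ 0 → s.degree = N)
    (hfA : ∀ k k', f k ⬝ᵥ A k' = if k = k' then Z else 0)
    {q t : ℕ} {x : (Fin r → ℕ) → Finset ι → MvPolynomial σ K}
    (hx : x ∈ chains r d q t) (h0 : enDiff f x = 0)
    (h1 : contrList f (List.finRange r) (x 0) = 0) :
    ∃ y ∈ chains r d (q + 1) (t + r * N), enDiff f y = Z ^ r • x := by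
  rcases q.eq_zero_or_pos with rfl | hq
  · obtain ⟨y, hy, -, hxy⟩ := exists_smul_eq_sum_contr hf hA hZ hfA (List.nodup_finRange r)
      (p := 0) (by simpa using (hx 0).1) h1
    simp only [List.length_finRange, zero_add] at hy hxy
    refine ⟨fun β => ∑ k, if β = Pi.single k 1 then y k else 0, fun β => ⟨?_, fun h => ?_⟩, ?_⟩
    · refine Submodule.sum_mem _ fun k _ => ?_
      split_ifs
      · exact hy k
      · exact zero_mem _
    · refine Finset.sum_eq_zero fun k _ => if_neg ?_
      rintro rfl
      exact h (by simp)
    · funext β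
      rw [enDiff_apply, Pi.smul_apply]
      rcases eq_or_ne β 0 with rfl | hβ
      · rw [hxy]
        refine Finset.sum_congr rfl fun k _ => ?_
        congr 1
        rw [Finset.sum_eq_single k]
        · simp
        · intro j _ hj
          refine if_neg fun h => ?_
          have := congrFun h k
          simp [hj.symm] at this
        · simp
      · have hs : ∑ k, β k ≠ 0 := fun h => hβ (funext fun k =>
          Finset.sum_eq_zero_iff.1 h k (Finset.mem_univ k))
        rw [(hx β).2 hs, smul_zero]
        refine Finset.sum_eq_zero fun k _ => ?_
        rw [Finset.sum_eq_zero, map_zero]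
        intro j _
        refine if_neg fun h => hs ?_
        have := congrArg (fun γ : Fin r → ℕ => ∑ k, γ k) h
        simp only [sum_add_single, Finset.sum_pi_single', Finset.mem_univ, if_true] at this
        simpa using this
  · obtain ⟨y, hy, x', hx', -, hxy, hx0⟩ :=
      exists_pow_smul_eq_enDiff_add hf hA hZ hfA (List.finRange r) hx h0
    rw [List.length_finRange] at hy hxy
    refine ⟨y, hy, ?_⟩
    have : x' = 0 := by
      funext β
      by_cases h : ∃ k ∈ List.finRange r, β k ≠ 0
      · exact hx0 β h
      · push Not at h
        refine (hx' β).2 ?_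
        rw [Finset.sum_eq_zero fun k _ => h k (List.mem_finRange k)]
        exact hq.ne
    rw [hxy, this, add_zero]

end Torsion

/-! ### Restriction to a coordinate hyperplane -/

section Restrict

variable {K : Type*} [CommRing K] {a : ℕ}

/-- Restriction of polynomials to the hyperplane `X 0 = 0`. -/
noncomputable def restrict (K : Type*) [CommRing K] (a : ℕ) :
    MvPolynomial (Fin (a + 1)) K →+* MvPolynomial (Fin a) K :=
  Polynomial.constantCoeff.comp (finSuccEquiv K a : _ →+* _)

theorem restrict_apply (p : MvPolynomial (Fin (a + 1)) K) :
    restrict K a p = (finSuccEquiv K a p).coeff 0 := rfl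

theorem coeff_restrict (p : MvPolynomial (Fin (a + 1)) K) (s : Fin a →₀ ℕ) :
    coeff s (restrict K a p) = coeff (Finsupp.cons 0 s) p := by
  rw [restrict_apply, finSuccEquiv_coeff_coeff]

theorem restrict_rename (p : MvPolynomial (Fin a) K) :
    restrict K a (rename Fin.succ p) = p := by
  induction p using MvPolynomial.induction_on with
  | C c =>
    rw [rename_C, restrict_apply, ← MvPolynomial.algebraMap_eq, AlgEquiv.commutes]
    simp [MvPolynomial.algebraMap_eq]
  | add p q hp hq => simp [hp, hq]
  | mul_X p i hp => rw [map_mul, map_mul, hp, rename_X, restrict_apply, finSuccEquiv_X_succ]; simp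

theorem exists_eq_X_mul_of_restrict {p : MvPolynomial (Fin (a + 1)) K} (h : restrict K a p = 0) :
    ∃ q, p = X 0 * q := by
  rw [restrict_apply, ← Polynomial.X_dvd_iff] at h
  obtain ⟨q, hq⟩ := h
  refine ⟨(finSuccEquiv K a).symm q, (finSuccEquiv K a).injective ?_⟩
  rw [map_mul, finSuccEquiv_X_zero, AlgEquiv.apply_symm_apply, hq]

theorem restrict_X_zero : restrict K a (X 0) = 0 := by
  rw [restrict_apply, finSuccEquiv_X_zero, Polynomial.coeff_X_zero]

theorem restrict_X_succ (l : Fin a) : restrict K a (X l.succ) = X l := by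
  rw [restrict_apply, finSuccEquiv_X_succ, Polynomial.coeff_C_zero]

theorem degree_cons (n : ℕ) (s : Fin a →₀ ℕ) : (Finsupp.cons n s).degree = n + s.degree := by
  simp [Finsupp.degree_eq_sum, Fin.sum_univ_succ]

variable {ι : Type*} {d : ι → ℕ} {r p t q : ℕ}

theorem restrict_mem_formPart {x : Finset ι → MvPolynomial (Fin (a + 1)) K}
    (hx : x ∈ formPart d p t) : restrict K a ∘ x ∈ formPart d p t := by
  intro J s h
  rw [Function.comp_apply, coeff_restrict] at h
  have := hx J _ h
  rwa [degree_cons, zero_add] at this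

theorem rename_mem_formPart {x : Finset ι → MvPolynomial (Fin a) K}
    (hx : x ∈ formPart d p t) :
    (fun J => rename Fin.succ (x J) : Finset ι → MvPolynomial (Fin (a + 1)) K) ∈
      formPart d p t := by
  intro J s h
  obtain ⟨u, rfl, hu⟩ := coeff_rename_ne_zero _ _ _ h
  rw [Finsupp.degree_mapDomain]
  exact hx J u hu

theorem mem_formPart_of_X_smul {x : Finset ι → MvPolynomial (Fin (a + 1)) K}
    (hx : X (R := K) (0 : Fin (a + 1)) • x ∈ formPart d p (t + 1)) : x ∈ formPart d p t := by
  intro J s h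
  rw [← coeff_X_mul s 0] at h
  have := hx J _ h
  rw [map_add, Finsupp.degree_single] at this
  exact ⟨this.1, by omega⟩

theorem X_smul_left_cancel {α : Type*} {x y : α → MvPolynomial (Fin (a + 1)) K}
    (h : X (R := K) (0 : Fin (a + 1)) • x = X (R := K) (0 : Fin (a + 1)) • y) : x = y :=
  funext fun J => by
    have hJ := congrFun h J
    rwa [Pi.smul_apply, Pi.smul_apply, smul_eq_mul, smul_eq_mul, X_mul_cancel_left_iff] at hJ

theorem exists_eq_X_smul {x : Finset ι → MvPolynomial (Fin (a + 1)) K}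
    (h : restrict K a ∘ x = 0) : ∃ y, x = X (R := K) (0 : Fin (a + 1)) • y := by
  choose y hy using fun J => exists_eq_X_mul_of_restrict (congrFun h J)
  exact ⟨y, funext hy⟩

theorem exists_chains_eq_X_smul
    {x : (Fin r → ℕ) → Finset ι → MvPolynomial (Fin (a + 1)) K} (hx : x ∈ chains r d q (t + 1))
    (h : ∀ β, restrict K a ∘ x β = 0) :
    ∃ y ∈ chains r d q t, x = X (R := K) (0 : Fin (a + 1)) • y := by
  choose y hy using fun β => exists_eq_X_smul (h β)
  refine ⟨y, fun β => ⟨mem_formPart_of_X_smul (hy β ▸ (hx β).1), fun hβ => ?_⟩, funext hy⟩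
  refine X_smul_left_cancel ?_
  rw [← hy, (hx β).2 hβ, smul_zero]

theorem restrict_mem_chains {x : (Fin r → ℕ) → Finset ι → MvPolynomial (Fin (a + 1)) K}
    (hx : x ∈ chains r d q t) : (fun β => restrict K a ∘ x β) ∈ chains r d q t := fun β =>
  ⟨restrict_mem_formPart (hx β).1, fun h => by funext J; simp [(hx β).2 h]⟩

theorem rename_mem_chains {x : (Fin r → ℕ) → Finset ι → MvPolynomial (Fin a) K}
    (hx : x ∈ chains r d q t) :
    (fun β J => rename Fin.succ (x β J) :
      (Fin r → ℕ) → Finset ι → MvPolynomial (Fin (a + 1)) K) ∈ chains r d q t := fun β =>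
  ⟨rename_mem_formPart (hx β).1, fun h => by funext J; simp [(hx β).2 h]⟩

end Restrict

/-! ### Exactness in large degrees -/

section Exactness

variable {K : Type*} [CommRing K] {a : ℕ} {ι : Type*} {d : ι → ℕ} {r : ℕ}

theorem degree_eq_of_coeff_X_pow {σ : Type*} (l : σ) (N : ℕ) (s : σ →₀ ℕ)
    (h : coeff s (X l ^ N : MvPolynomial σ K) ≠ 0) : s.degree = N := by
  classical
  rw [coeff_X_pow] at h
  have : Finsupp.single l N = s := by by_contra h'; simp [h'] at h
  rw [← this, Finsupp.degree_single]

theorem restrict_degree {f : Fin r → ι → MvPolynomial (Fin (a + 1)) K}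
    (hf : ∀ k j s, coeff s (f k j) ≠ 0 → s.degree = d j) (k : Fin r) (j : ι) (s : Fin a →₀ ℕ)
    (h : coeff s ((restrict K a ∘ f k) j) ≠ 0) : s.degree = d j := by
  rw [Function.comp_apply, coeff_restrict] at h
  have := hf k j _ h
  rwa [degree_cons, zero_add] at this

variable [Fintype ι]

/-- `f` has a homogeneous right inverse up to a power of the variable `X l`. -/
def SplitsAt (d : ι → ℕ) (f : Fin r → ι → MvPolynomial (Fin a) K) (l : Fin a) : Prop :=
  ∃ (N : ℕ) (A : Fin r → ι → MvPolynomial (Fin a) K),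
    (∀ k j s, coeff s (A k j) ≠ 0 → s.degree + d j = N) ∧
    ∀ k k', f k ⬝ᵥ A k' = if k = k' then X l ^ N else 0

theorem SplitsAt.restrict {f : Fin r → ι → MvPolynomial (Fin (a + 1)) K} {l : Fin a}
    (h : SplitsAt d f l.succ) : SplitsAt d (fun k => restrict K a ∘ f k) l := by
  obtain ⟨N, A, hA, hfA⟩ := h
  refine ⟨N, fun k => EagonNorthcott.restrict K a ∘ A k, fun k j s h => ?_, fun k k' => ?_⟩
  · dsimp only at h
    rw [Function.comp_apply, coeff_restrict] at h
    have := hA k j _ h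
    rwa [degree_cons, zero_add] at this
  · have := congrArg (EagonNorthcott.restrict K a) (hfA k k')
    rw [dotProduct, map_sum] at this
    simp only [map_mul] at this
    rw [dotProduct]
    refine this.trans ?_
    split_ifs <;> simp [restrict_X_succ]

variable [LinearOrder ι]

theorem restrict_enDiff_rename (f : Fin r → ι → MvPolynomial (Fin (a + 1)) K)
    (w : (Fin r → ℕ) → Finset ι → MvPolynomial (Fin a) K) (β : Fin r → ℕ) :
    restrict K a ∘ enDiff f (fun β J => rename Fin.succ (w β J)) β =
      enDiff (fun k => restrict K a ∘ f k) w β := by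
  rw [map_enDiff]
  have hw : (fun β => restrict K a ∘ fun J => rename Fin.succ (w β J)) = w := by
    funext β J
    exact restrict_rename _
  rw [hw]

/-- Vanishing of the homology of the Eagon–Northcott complex in large internal degrees. The degree
hypothesis concerns only the term `a` steps further left in the complex, `a` being the number of
variables: restricting to `X 0 = 0` moves one step to the left and removes one variable. -/
theorem exists_enDiff_eq (f : Fin r → ι → MvPolynomial (Fin a) K)
    (hf : ∀ k j s, coeff s (f k j) ≠ 0 → s.degree = d j) (hs : ∀ l, SplitsAt d f l)
    {q t : ℕ} {x : (Fin r → ℕ) → Finset ι → MvPolynomial (Fin a) K} (hx : x ∈ chains r d q t)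
    (h0 : enDiff f x = 0) (h1 : contrList f (List.finRange r) (x 0) = 0)
    (hd : ∀ J : Finset ι, J.card = r + q + a → ∑ j ∈ J, d j < t + a) :
    ∃ y ∈ chains r d (q + 1) t, enDiff f y = x := by
  induction a generalizing q t with
  | zero =>
    -- over the constants, a nonzero coefficient at `e_J` forces `∑ j ∈ J, d j = t`
    refine ⟨0, zero_mem _, ?_⟩
    rw [map_zero]
    funext β J
    ext s
    by_contra h
    obtain ⟨hJ, ht⟩ := (hx β).1 J s (Ne.symm h)
    have := hd J hJ
    rw [Subsingleton.elim s 0, map_zero] at ht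
    omega
  | succ a ih =>
    -- descent: if `X 0 * x` is the boundary of `y`, then `y` is a cycle modulo `X 0`, hence a
    -- boundary modulo `X 0`; correcting `y` by a boundary makes it divisible by `X 0`
    have key : ∀ (k t : ℕ) (x : (Fin r → ℕ) → Finset ι → MvPolynomial (Fin (a + 1)) K),
        (∀ J : Finset ι, J.card = r + q + (a + 1) → ∑ j ∈ J, d j < t + (a + 1)) →
        (∃ y ∈ chains r d (q + 1) (t + k),
          enDiff f y = (X 0 : MvPolynomial (Fin (a + 1)) K) ^ k • x) →
        ∃ y ∈ chains r d (q + 1) t, enDiff f y = x := by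
      intro k
      induction k with
      | zero => simp
      | succ k ihk =>
        rintro t x hd ⟨y, hy, hyx⟩
        refine ihk t x hd ?_
        obtain ⟨w, hw, hwy⟩ := ih (fun k => restrict K a ∘ f k) (restrict_degree hf)
          (fun l => (hs l.succ).restrict) (restrict_mem_chains hy) (by
            funext β
            rw [← map_enDiff, hyx]
            funext J
            simp [pow_succ, restrict_X_zero]) (by
            have hy0 : restrict K a ∘ y 0 = 0 := (restrict_mem_chains hy 0).2 (by simp)
            rw [hy0]
            simpa using contrList_smul (fun k => restrict K a ∘ f k) (List.finRange r) 0 0)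
          (fun J hJ => by have := hd J (by omega); omega)
        have hw' := rename_mem_chains hw
        obtain ⟨y', hy', hyy'⟩ := exists_chains_eq_X_smul (t := t + k)
          (sub_mem hy (enDiff_mem hf hw')) (by
            intro β
            rw [Pi.sub_apply]
            funext J
            have := congrFun ((restrict_enDiff_rename f w β).trans (congrFun hwy β)) J
            simp only [Function.comp_apply] at this
            simp [this])
        refine ⟨y', hy', ?_⟩
        have h2 := congrArg (enDiff f) hyy'
        rw [map_sub, enDiff_enDiff, sub_zero, hyx, map_smul, pow_succ', mul_smul] at h2
        funext β
        exact (X_smul_left_cancel (congrFun h2 β)).symm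
    obtain ⟨N, A, hA, hfA⟩ := hs 0
    refine key (r * N) t x hd ?_
    rw [mul_comm r N, pow_mul, mul_comm N r]
    exact exists_pow_smul_eq_enDiff hf hA (degree_eq_of_coeff_X_pow 0 N) hfA hx h0 h1

/-- The ideal of maximal minors contains `X 0 ^ t`, as an iterated contraction by the rows of
`f`, when `t + a` is at least all degree sums over `r + a` columns. -/
theorem exists_contrList_eq_X_pow (f : Fin r → ι → MvPolynomial (Fin (a + 1)) K)
    (hf : ∀ k j s, coeff s (f k j) ≠ 0 → s.degree = d j) (hs : ∀ l, SplitsAt d f l) {t : ℕ}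
    (hd : ∀ J : Finset ι, J.card = r + a → ∑ j ∈ J, d j < t + (a + 1)) :
    ∃ x ∈ formPart d r t,
      contrList f (List.finRange r) x = Pi.single ∅ (X (R := K) 0 ^ t) := by
  -- the same descent as in `exists_enDiff_eq`, one step further right in the complex
  have key : ∀ k, (∃ x ∈ formPart d r (t + k), contrList f (List.finRange r) x =
      Pi.single ∅ (X (R := K) 0 ^ (t + k))) → ∃ x ∈ formPart d r t,
      contrList f (List.finRange r) x = Pi.single ∅ (X (R := K) 0 ^ t) := by
    intro k
    induction k with
    | zero => exact id
    | succ k ihk =>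
      rintro ⟨x, hx, hxs⟩
      refine ihk ?_
      have hP : (Pi.single ∅ (X (R := K) 0 ^ (t + (k + 1))) : Finset ι → _) =
          X (R := K) (0 : Fin (a + 1)) • (Pi.single ∅ (X 0 ^ (t + k)) :
            Finset ι → MvPolynomial (Fin (a + 1)) K) := by
        rw [← Pi.single_smul, smul_eq_mul, ← add_assoc, pow_succ']
      -- `x` as a chain with `q = 0`
      set x₀ : (Fin r → ℕ) → Finset ι → MvPolynomial (Fin (a + 1)) K := Pi.single 0 x with hx₀
      have hx₀m : x₀ ∈ chains r d 0 (t + (k + 1)) := by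
        intro β
        rcases eq_or_ne β 0 with rfl | hβ
        · simpa [hx₀] using hx
        · rw [hx₀, Pi.single_eq_of_ne hβ]
          exact ⟨zero_mem _, fun _ => rfl⟩
      have hr0 : (restrict K a ∘ x₀ 0) = restrict K a ∘ x := by rw [hx₀, Pi.single_eq_same]
      obtain ⟨w, hw, hwx⟩ := exists_enDiff_eq (fun k => restrict K a ∘ f k) (restrict_degree hf)
          (fun l => (hs l.succ).restrict) (restrict_mem_chains hx₀m) (by
            funext β
            rw [enDiff_apply]
            refine Finset.sum_eq_zero fun k _ => ?_
            have hk : restrict K a ∘ x₀ (β + Pi.single k 1) = 0 :=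
              (restrict_mem_chains hx₀m _).2 (by rw [sum_add_single]; omega)
            rw [hk, map_zero]) (by
            rw [hr0, ← map_contrList, hxs, hP]
            funext J
            simp [restrict_X_zero])
          (fun J hJ => by have := hd J (by omega); omega)
      have hw' := rename_mem_chains hw
      have hwr := ((restrict_enDiff_rename f w 0).trans (congrFun hwx 0)).trans hr0
      have hw0 := (enDiff_mem hf hw' 0).1
      obtain ⟨y, hy⟩ := exists_eq_X_smul (x := x - enDiff f (fun β J => rename Fin.succ (w β J)) 0)
        (by
          funext J
          have := congrFun hwr J
          simp only [Function.comp_apply] at this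
          simp [this])
      refine ⟨y, mem_formPart_of_X_smul (hy ▸ sub_mem hx hw0), X_smul_left_cancel ?_⟩
      rw [← contrList_smul, ← hy, contrList_sub, contrList_enDiff, sub_zero, hxs, hP]
  obtain ⟨N, A, hA, hfA⟩ := hs 0
  refine key (r * N) ?_
  obtain ⟨y, hy, hyx⟩ := exists_contrList_eq_pow_smul hA hfA (List.nodup_finRange r)
    (p := 0) (t := t) (x := Pi.single ∅ (X (R := K) 0 ^ t)) (by
      intro J s h
      rcases eq_or_ne J ∅ with rfl | hJ
      · rw [Pi.single_eq_same] at h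
        simpa using degree_eq_of_coeff_X_pow _ _ _ h
      · rw [Pi.single_eq_of_ne hJ] at h
        simp at h) (by
      intro k _
      funext J
      rw [contr_apply, Pi.zero_apply]
      refine Finset.sum_eq_zero fun i _ => ?_
      split_ifs
      · exact mul_zero _
      · rw [Pi.single_eq_of_ne (Finset.insert_ne_empty i J), mul_zero, mul_zero])
  rw [List.length_finRange] at hy hyx
  refine ⟨y, by simpa using hy, ?_⟩
  rw [hyx, ← Pi.single_smul, smul_eq_mul, ← pow_mul, mul_comm N, ← pow_add, add_comm (r * N)]

end Exactness

/-! ### Matrices of forms that are surjective away from the origin -/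

section Surjective

variable {n r : ℕ} {ι : Type*} [Fintype ι] {d : ι → ℕ}

/-- Cramer's rule turns a presentation of `X 0 ^ t` by maximal minors into a right inverse of `f` up
to the factor `X 0 ^ t`. -/
theorem exists_mul_eq_X_pow_smul {K : Type*} [CommRing K] [LinearOrder ι]
    (f : Matrix (Fin r) ι (MvPolynomial (Fin (n + 1)) K))
    (hf : ∀ k j s, coeff s (f k j) ≠ 0 → s.degree = d j) (hs : ∀ l, SplitsAt d f l) {t : ℕ}
    (hd : ∀ J : Finset ι, J.card = r + n → ∑ j ∈ J, d j < t + (n + 1)) :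
    ∃ Q : Matrix ι (Fin r) (MvPolynomial (Fin (n + 1)) K),
      f * Q = (X 0 ^ t : MvPolynomial (Fin (n + 1)) K) • (1 : Matrix (Fin r) (Fin r) _) ∧
      ∀ j k s, coeff s (Q j k) ≠ 0 → s.degree + d j = t := by
  obtain ⟨x, hx, hxt⟩ := exists_contrList_eq_X_pow f hf hs hd
  have h1 : ∀ k, ∃ y ∈ formPart d 1 t, contrList f (List.finRange r) x = contr (f k) y ∧
      ∀ j, j ≠ k → contr (f j) y = 0 := by
    intro k
    obtain ⟨y, hy, hxy, hjy⟩ := exists_contrList_eq f (List.nodup_finRange r) (List.mem_finRange k)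
      (fun p x => x ∈ formPart d p t) (fun p x hx => neg_mem hx)
      (fun p x i hx => contr_mem (hf i) hx) (p := 0) (x := x) (by simpa using hx)
    exact ⟨y, hy, hxy, fun j => hjy j (List.mem_finRange j)⟩
  choose y hy hxy hjy using h1
  refine ⟨Matrix.of fun j k => y k {j}, ?_, fun j k s h => ?_⟩
  · have h2 : ∀ i k, (f * Matrix.of fun j k => y k {j}) i k = contr (f i) (y k) ∅ := by
      intro i k
      rw [Matrix.mul_apply, contr_apply]
      simp [sgn]
    ext1 i k
    rw [h2, Matrix.smul_apply, Matrix.one_apply]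
    split_ifs with h
    · rw [h, ← hxy k, hxt, Pi.single_eq_same, smul_eq_mul, mul_one]
    · rw [hjy k i h, Pi.zero_apply, smul_zero]
  · have := hy k {j} s h
    simpa using this.2

/-- The ideal of all `s` for which `f` has a right inverse up to the factor `s`. -/
def splitIdeal {R : Type*} [CommRing R] (f : Matrix (Fin r) ι R) : Ideal R where
  carrier := {s | ∃ A : Matrix ι (Fin r) R, f * A = s • (1 : Matrix (Fin r) (Fin r) R)}
  zero_mem' := ⟨0, by simp⟩
  add_mem' := by
    rintro s s' ⟨A, hA⟩ ⟨A', hA'⟩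
    exact ⟨A + A', by rw [Matrix.mul_add, hA, hA', add_smul]⟩
  smul_mem' := by
    rintro c s ⟨A, hA⟩
    exact ⟨c • A, by rw [Matrix.mul_smul, hA, smul_smul, smul_eq_mul]⟩

variable {K : Type*} [Field K]

/-- By the Nullstellensatz it is enough that no point `z ≠ 0` is a zero of `splitIdeal f`; at such a
point the determinant of `f * B`, with `B` a constant right inverse of `f z`, does not vanish. -/
theorem X_mem_radical_splitIdeal [IsAlgClosed K]
    (f : Matrix (Fin r) ι (MvPolynomial (Fin (n + 1)) K))
    (hsurj : ∀ z : Fin (n + 1) → K, z ≠ 0 → Function.Surjective (f.map (eval z)).mulVec)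
    (l : Fin (n + 1)) : X l ∈ (splitIdeal f).radical := by
  classical
  rw [← vanishingIdeal_zeroLocus_eq_radical (K := K), mem_vanishingIdeal_iff]
  intro z hz
  rw [aeval_X]
  by_contra hl
  obtain ⟨B, hB⟩ := Matrix.mulVec_surjective_iff_exists_right_inverse.1
    (hsurj z fun h => hl (by rw [h]; rfl))
  let B' : Matrix ι (Fin r) (MvPolynomial (Fin (n + 1)) K) := B.map C
  let D : Matrix (Fin r) (Fin r) (MvPolynomial (Fin (n + 1)) K) := f * B'
  have hadj : f * (B' * D.adjugate) = D.det • (1 : Matrix (Fin r) (Fin r) _) := by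
    rw [← Matrix.mul_assoc]
    exact Matrix.mul_adjugate D
  have h0 : eval z D.det = 0 := by
    rw [← coe_aeval_eq_eval]
    exact mem_zeroLocus_iff.1 hz D.det ⟨_, hadj⟩
  have hBC : B'.map (eval z) = B := by
    ext1 i j
    simp [B']
  have hDz : D.map (eval z) = 1 := by rw [← hB, ← hBC]; exact Matrix.map_mul
  rw [RingHom.map_det, RingHom.mapMatrix_apply, hDz, Matrix.det_one] at h0
  exact one_ne_zero h0

theorem isHomogeneous_iff_coeff {σ R : Type*} [CommSemiring R] {p : MvPolynomial σ R} {e : ℕ} :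
    p.IsHomogeneous e ↔ ∀ s, coeff s p ≠ 0 → s.degree = e := by
  rw [IsHomogeneous, IsWeightedHomogeneous, Finsupp.degree_eq_weight_one]
  rfl

theorem homogeneousComponent_mul_of_isHomogeneous {σ R : Type*} [CommSemiring R]
    {p q : MvPolynomial σ R} {e N : ℕ} (hp : p.IsHomogeneous e) (h : e ≤ N) :
    homogeneousComponent N (p * q) = p * homogeneousComponent (N - e) q := by
  classical
  ext s
  rw [coeff_homogeneousComponent, coeff_mul, coeff_mul]
  have hterm : ∀ u ∈ Finset.HasAntidiagonal.antidiagonal s,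
      coeff u.1 p * coeff u.2 (homogeneousComponent (N - e) q) =
        if s.degree = N then coeff u.1 p * coeff u.2 q else 0 := by
    rintro ⟨u, v⟩ huv
    rw [← Finset.HasAntidiagonal.mem_antidiagonal.1 huv, map_add, coeff_homogeneousComponent]
    by_cases hu : coeff u p = 0
    · simp [hu]
    · rw [isHomogeneous_iff_coeff.1 hp u hu, mul_ite, mul_zero]
      exact if_congr (by omega) rfl rfl
  rw [Finset.sum_congr rfl hterm]
  split_ifs <;> simp

theorem splitsAt_of_surjective [IsAlgClosed K]
    (f : Matrix (Fin r) ι (MvPolynomial (Fin (n + 1)) K))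
    (hf : ∀ k j s, coeff s (f k j) ≠ 0 → s.degree = d j)
    (hsurj : ∀ z : Fin (n + 1) → K, z ≠ 0 → Function.Surjective (f.map (eval z)).mulVec)
    (l : Fin (n + 1)) : SplitsAt d f l := by
  obtain ⟨M, hM⟩ := X_mem_radical_splitIdeal f hsurj l
  -- a common exponent that is at least all `d j`, so that `N - d j` is not truncated
  set N := M + ∑ j, d j
  have hdN : ∀ j, d j ≤ N := fun j =>
    (Finset.single_le_sum (f := d) (fun _ _ => Nat.zero_le _) (Finset.mem_univ j)).trans
      (Nat.le_add_left _ _)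
  obtain ⟨A, hA⟩ : X l ^ N ∈ splitIdeal f := by
    rw [pow_add]; exact Ideal.mul_mem_right _ _ hM
  refine ⟨N, fun k j => homogeneousComponent (N - d j) (A j k), fun k j s h => ?_, fun k k' => ?_⟩
  · have := isHomogeneous_iff_coeff.1 (homogeneousComponent_isHomogeneous (N - d j) (A j k)) s h
    have := hdN j
    omega
  · have h1 := congrArg (homogeneousComponent N) (congrFun (congrFun hA k) k')
    rw [Matrix.mul_apply, map_sum, Matrix.smul_apply, Matrix.one_apply, smul_eq_mul,
      mul_ite, mul_one, mul_zero] at h1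
    rw [dotProduct]
    refine (Finset.sum_congr rfl fun j _ => ?_).trans (h1.trans ?_)
    · exact (homogeneousComponent_mul_of_isHomogeneous
        (isHomogeneous_iff_coeff.2 (hf k j)) (hdN j)).symm
    · split_ifs
      · rw [homogeneousComponent_of_mem (isHomogeneous_X_pow l N), if_pos rfl]
      · rw [map_zero]

end Surjective

/-! ### Dehomogenization -/

section Dehomogenize

variable {n : ℕ}

theorem coeff_homogenizeTo_ne_zero {e : ℕ} {p : MvPolynomial (Fin n) ℂ} (hp : p.totalDegree ≤ e)
    (s : Fin (n + 1) →₀ ℕ) (h : coeff s (homogenizeTo e p) ≠ 0) : s.degree = e := by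
  classical
  rw [homogenizeTo, coeff_sum] at h
  obtain ⟨u, hu, h⟩ := Finset.exists_ne_zero_of_sum_ne_zero h
  rw [coeff_monomial] at h
  have hs : Finsupp.cons (e - u.degree) u = s := by by_contra h'; simp [h'] at h
  have hu' : u.degree ≤ e := by
    refine le_trans ?_ hp
    rw [Finsupp.degree_apply]
    exact le_totalDegree hu
  rw [← hs, degree_cons]
  omega

/-- Substitution of `1` for the homogenizing variable. -/
noncomputable def dehomogenize (n : ℕ) :
    MvPolynomial (Fin (n + 1)) ℂ →ₐ[ℂ] MvPolynomial (Fin n) ℂ :=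
  aeval (Fin.cons 1 X)

theorem dehomogenize_monomial (s : Fin (n + 1) →₀ ℕ) (c : ℂ) :
    dehomogenize n (monomial s c) = monomial s.tail c := by
  rw [dehomogenize, aeval_monomial, Finsupp.prod_fintype _ _ (fun _ => pow_zero _),
    Fin.prod_univ_succ, monomial_eq, Finsupp.prod_fintype _ _ (fun _ => pow_zero _)]
  simp [MvPolynomial.algebraMap_eq, Finsupp.tail_apply]

theorem dehomogenize_homogenizeTo (e : ℕ) (p : MvPolynomial (Fin n) ℂ) :
    dehomogenize n (homogenizeTo e p) = p := by
  rw [homogenizeTo, map_sum]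
  simp only [dehomogenize_monomial, Finsupp.tail_cons]
  exact p.support_sum_monomial_coeff

theorem totalDegree_dehomogenize_le {t : ℕ} {p : MvPolynomial (Fin (n + 1)) ℂ}
    (hp : ∀ s, coeff s p ≠ 0 → s.degree = t) : (dehomogenize n p).totalDegree ≤ t := by
  rw [← p.support_sum_monomial_coeff, map_sum]
  refine totalDegree_finsetSum_le fun s hs => ?_
  rw [dehomogenize_monomial]
  refine (totalDegree_monomial_le _ _).trans ?_
  rw [← hp s (mem_support_iff.1 hs), Finsupp.degree_eq_sum, Fin.sum_univ_succ,
    Finsupp.sum_fintype _ _ (fun _ => rfl)]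
  simp [Finsupp.tail_apply]

end Dehomogenize

/-! ### Degree bounds -/

theorem val_le_of_strictMono {a b : ℕ} {g : Fin a → Fin b} (hg : StrictMono g) (i : Fin a) :
    (i : ℕ) ≤ g i := by
  obtain ⟨i, hi⟩ := i
  induction i with
  | zero => exact Nat.zero_le _
  | succ i ih =>
    have h1 := ih (by omega)
    have h2 : g ⟨i, by omega⟩ < g ⟨i + 1, hi⟩ := hg (by simp [Fin.lt_def])
    rw [Fin.lt_def] at h2
    simp only at h1 ⊢
    omega

theorem sum_le_sum_castLE_of_antitone {a m : ℕ} {d : Fin m → ℕ} (hd : Antitone d) (h : a ≤ m)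
    {J : Finset (Fin m)} (hJ : J.card = a) : ∑ j ∈ J, d j ≤ ∑ j : Fin a, d (Fin.castLE h j) := by
  rw [← J.map_orderEmbOfFin_univ hJ, Finset.sum_map]
  refine Finset.sum_le_sum fun i _ => hd ?_
  exact val_le_of_strictMono (J.orderEmbOfFin hJ).strictMono i

end EagonNorthcott

theorem surjective_of_nonSurjectiveLocus_eq_empty {n m r : ℕ}
    {f : Matrix (Fin r) (Fin m) (MvPolynomial (Fin (n + 1)) ℂ)} (h : nonSurjectiveLocus f = ∅)
    (z : Fin (n + 1) → ℂ) (hz : z ≠ 0) : Function.Surjective (f.map (eval z)).mulVec := by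
  by_contra hs
  have : Projectivization.mk ℂ z hz ∈ nonSurjectiveLocus f := ⟨z, hz, rfl, hs⟩
  rw [h] at this
  exact this

open EagonNorthcott in
/-- The degree bound for any `t` such that `t + n` is at least all degree sums over `n + r` columns;
if there are fewer than `n + r` columns, this includes `t = 0`. -/
theorem exists_mul_eq_one_totalDegree_le {n m r : ℕ} {d : Fin m → ℕ}
    {P : Matrix (Fin r) (Fin m) (MvPolynomial (Fin n) ℂ)}
    (hP : ∀ i j, (P i j).totalDegree ≤ d j)
    (hZ : nonSurjectiveLocus (homogenizeColumns d P) = ∅) {t : ℕ}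
    (ht : ∀ J : Finset (Fin m), J.card = n + r → ∑ j ∈ J, d j ≤ t + n) :
    ∃ Q : Matrix (Fin m) (Fin r) (MvPolynomial (Fin n) ℂ),
      P * Q = 1 ∧ ∀ k i l, (P i k * Q k l).totalDegree ≤ t := by
  set f := homogenizeColumns d P
  have hf : ∀ k j s, coeff s (f k j) ≠ 0 → s.degree = d j := fun k j s h =>
    coeff_homogenizeTo_ne_zero (hP k j) s h
  have hfP : ∀ i j, dehomogenize n (f i j) = P i j := fun i j => dehomogenize_homogenizeTo _ _
  obtain ⟨Q, hQ, hQd⟩ := exists_mul_eq_X_pow_smul f hf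
    (splitsAt_of_surjective f hf (surjective_of_nonSurjectiveLocus_eq_empty hZ)) (t := t)
    (fun J hJ => by have := ht J (by omega); omega)
  refine ⟨Q.map (dehomogenize n), ?_, fun k i l => ?_⟩
  · ext1 i l
    have := congrArg (dehomogenize n) (congrFun (congrFun hQ i) l)
    rw [Matrix.mul_apply, map_sum] at this
    simp only [map_mul, hfP] at this
    rw [Matrix.mul_apply]
    refine this.trans ?_
    rw [Matrix.smul_apply, smul_eq_mul, map_mul, map_pow, dehomogenize, aeval_X, Fin.cons_zero,
      one_pow, one_mul, Matrix.one_apply, Matrix.one_apply, apply_ite (aeval _), map_one, map_zero]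
  · rw [Matrix.map_apply, ← hfP, ← map_mul]
    refine totalDegree_dehomogenize_le fun s h => ?_
    obtain ⟨u, v, rfl, hu, hv⟩ := exists_coeff_ne_zero_of_coeff_mul h
    rw [map_add, hf i k u hu, add_comm]
    exact hQd k l v hv

theorem mainTheorem11 (n m r : ℕ) (d : Fin m → ℕ) (hd : Antitone d)
    (P : Matrix (Fin r) (Fin m) (MvPolynomial (Fin n) ℂ))
    (hP : ∀ i j, (P i j).totalDegree ≤ d j)
    (hZ : nonSurjectiveLocus (homogenizeColumns d P) = ∅) :
    ∃ Q : Matrix (Fin m) (Fin r) (MvPolynomial (Fin n) ℂ),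
      P * Q = 1 ∧
      (∀ h : n + r ≤ m, ∀ k i l,
        ((P i k * Q k l).totalDegree : ℤ) ≤
          max 0 ((∑ j : Fin (n + r), (d (Fin.castLE h j) : ℤ)) - n)) ∧
      (m < n + r → ∀ k i l, (P i k * Q k l).totalDegree = 0) := by
  by_cases h : n + r ≤ m
  · -- the truncated subtraction in `t` is the maximum with `0`
    obtain ⟨Q, hPQ, hQ⟩ := exists_mul_eq_one_totalDegree_le hP hZ
      (t := ∑ j : Fin (n + r), d (Fin.castLE h j) - n)
      (fun J hJ => by have := EagonNorthcott.sum_le_sum_castLE_of_antitone hd h hJ; omega)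
    refine ⟨Q, hPQ, fun _ k i l => ?_, fun h' => absurd h h'.not_ge⟩
    have := hQ k i l
    rw [← Nat.cast_sum]
    omega
  · obtain ⟨Q, hPQ, hQ⟩ := exists_mul_eq_one_totalDegree_le hP hZ (t := 0) (fun J hJ => by
      have := J.card_le_univ
      rw [Fintype.card_fin] at this
      omega)
    exact ⟨Q, hPQ, fun h' => absurd h' h, fun _ k i l => Nat.le_zero.1 (hQ k i l)⟩
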